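/- Let $d \ge 2$ and let $S^d$ be the unit sphere of $\mathbb{R}^{d+1}$ with the spherical distance $|ab|$ (the length of the shorter great-circle arc $ab$ joining $a$ and $b$). Put $\operatorname{diam}(A)=\sup_{a,b\in A}|ab|$. A hemisphere with center $c$ is the set of points at distance at most $\pi/2$ from $c$. A convex body on $S^d$ is a closed set with non-empty interior that contains no pair of antipodal points and contains, with any two of its points, the arc joining them. A subset $K$ of a hemisphere with $\operatorname{diam}(K)\in(0,\pi/2)$ is complete if $\operatorname{diam}(K\cup\{x\})>\operatorname{diam}(K)$ for every $x\in S^d\setminus K$. A lune is the intersection $G\cap H$ of two hemispheres that are different and not opposite (their centers are neither equal nor antipodal); its thickness is the spherical distance between the centers of the two $(d-1)$-dimensional hemispheres $\operatorname{bd}(G)\cap H$ and $\operatorname{bd}(H)\cap G$ that bound it. A hemisphere $H$ supports a convex body $C$ if $C\subset H$ and $\operatorname{bd}(H)\cap C\neq\emptyset$; the width of $C$ determined by such an $H$ is the minimum thickness of a lune $H\cap H'$ containing $C$, where $H'$ is a hemisphere. The body $C$ is of constant width $w$ if its width determined by every supporting hemisphere equals $w$. **Theorem.** Let $K$ be a convex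 body on $S^d$ of diameter $\delta\in(0,\pi/2)$. Then $K$ is complete if and only if $K$ is of constant width $\delta$. -/

import Mathlib

namespace SphConv

noncomputable section

/-- The unit sphere `S^d` of the `(d+1)`-dimensional Euclidean space. -/
abbrev Sph (d : ℕ) : Type := Metric.sphere (0 : EuclideanSpace ℝ (Fin (d + 1))) 1

/-- Spherical distance: the length of the (shorter) great-circle arc joining `a` and `b`,
that is, the angle between the unit vectors `a` and `b`. -/
def sdist {d : ℕ} (a b : Sph d) : ℝ :=
  InnerProductGeometry.angle (a : EuclideanSpace ℝ (Fin (d + 1))) (b : EuclideanSpace ℝ (Fin (d + 1)))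

/-- Diameter of a subset of the sphere with respect to the spherical distance. -/
def sdiam {d : ℕ} (A : Set (Sph d)) : ℝ :=
  sSup {t : ℝ | ∃ a ∈ A, ∃ b ∈ A, t = sdist a b}

/-- The spherical ball of radius `ρ` with center `c`. -/
def sball {d : ℕ} (c : Sph d) (ρ : ℝ) : Set (Sph d) := {x | sdist c x ≤ ρ}

/-- The hemisphere with center `c`. -/
def hemisphere {d : ℕ} (c : Sph d) : Set (Sph d) := sball c (Real.pi / 2)

/-- The arc `ab` joining two points that are not antipodes: the part of the great circle through
`a` and `b` lying in the cone spanned by `a` and `b` (just `{a}` if `a = b`). -/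
def arc {d : ℕ} (a b : Sph d) : Set (Sph d) :=
  {x | ∃ s t : ℝ, 0 ≤ s ∧ 0 ≤ t ∧
    (x : EuclideanSpace ℝ (Fin (d + 1))) =
      s • (a : EuclideanSpace ℝ (Fin (d + 1))) + t • (b : EuclideanSpace ℝ (Fin (d + 1)))}

/-- A subset of the sphere is convex if it contains no pair of antipodes and, with any two
points, the arc joining them. -/
def IsConvex {d : ℕ} (A : Set (Sph d)) : Prop :=
  (∀ a ∈ A, -a ∉ A) ∧ ∀ a ∈ A, ∀ b ∈ A, arc a b ⊆ A

/-- A convex body: a closed convex set with non-empty interior (in the sphere). -/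
structure IsConvexBody {d : ℕ} (C : Set (Sph d)) : Prop where
  convex : IsConvex C
  isClosed : IsClosed C
  interior_nonempty : (interior C).Nonempty

/-- The hemisphere with center `g` supports `C`. -/
def Supports {d : ℕ} (g : Sph d) (C : Set (Sph d)) : Prop :=
  C ⊆ hemisphere g ∧ (frontier (hemisphere g) ∩ C).Nonempty

/-- The hemispheres with centers `g` and `h` are different and not opposite, so that
their intersection is a lune. -/
def IsLunePair {d : ℕ} (g h : Sph d) : Prop := g ≠ h ∧ g ≠ -h

/-- The lune `G ∩ H`, where `G`, `H` are the hemispheres with centers `g`, `h`. -/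
def lune {d : ℕ} (g h : Sph d) : Set (Sph d) := hemisphere g ∩ hemisphere h

/-- `G/H`, the `(d-1)`-dimensional hemisphere bounding the lune `G ∩ H` and contained in the
boundary of `G`, where `G`, `H` are the hemispheres with centers `g`, `h`. -/
def luneFace {d : ℕ} (g h : Sph d) : Set (Sph d) := frontier (hemisphere g) ∩ hemisphere h

/-- `p` is the center of the `(d-1)`-dimensional hemisphere `G/H` of the
`(d-1)`-dimensional great sphere bounding `G`. -/
def IsFaceCenter {d : ℕ} (g h p : Sph d) : Prop :=
  p ∈ frontier (hemisphere g) ∧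
    luneFace g h = {x | x ∈ frontier (hemisphere g) ∧ sdist p x ≤ Real.pi / 2}

/-- The lune `G ∩ H` has thickness `t`: the spherical distance between the centers of `G/H`
and `H/G` is `t`. -/
def HasThickness {d : ℕ} (g h : Sph d) (t : ℝ) : Prop :=
  ∃ p q : Sph d, IsFaceCenter g h p ∧ IsFaceCenter h g q ∧ sdist p q = t

/-- The width of `C` determined by the hemisphere with center `g` is `w`: the number `w` is the
minimum of the thicknesses of the lunes `G ∩ H` containing `C`, where `H` is a hemisphere. -/
def HasWidth {d : ℕ} (g : Sph d) (C : Set (Sph d)) (w : ℝ) : Prop :=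
  IsLeast {t : ℝ | ∃ h : Sph d, IsLunePair g h ∧ C ⊆ lune g h ∧ HasThickness g h t} w

/-- `C` is of constant width `w`: the width determined by each supporting hemisphere is `w`. -/
def IsConstantWidth {d : ℕ} (C : Set (Sph d)) (w : ℝ) : Prop :=
  ∀ g : Sph d, Supports g C → HasWidth g C w

/-- Complete sets: subsets of a hemisphere, of diameter in `(0, π/2)`, such that adding any extra
point increases the diameter. -/
structure IsCompleteSet {d : ℕ} (K : Set (Sph d)) : Prop where
  diam_pos : 0 < sdiam K
  diam_lt : sdiam K < Real.pi / 2
  subset_hemisphere : ∃ c : Sph d, K ⊆ hemisphere c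
  diam_insert : ∀ x : Sph d, x ∉ K → sdiam K < sdiam (insert x K)

end

end SphConv

namespace SphConv

open scoped InnerProductSpace
open Filter Topology

variable {d : ℕ}

/-! With `sdist` rewritten through inner products, the width at a contact point `p` of a supporting
hemisphere with center `g` is governed by how high `K` rises in direction `g`. Bessel's inequality
(`ip_le_sin`) bounds this height by `sin δ`, with equality only at `k = cos δ • p + sin δ • g`.

Complete implies constant width: `k` must lie in `K` (`exists_mem_eq_cos_smul_add_sin_smul`).
Otherwise some `q ∈ K` is too far from `k`. Leaving `K` from `p` along a tangent direction adapted
to `q` produces, by completeness and compactness, a point `z₀ ∈ K` at distance exactly `δ` from `p`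
but farther than `δ` from `q`. Once `k ∈ K`, `hasWidth_of_mem` gives width `δ`.

Constant width implies complete: for `x ∉ K` take the nearest point `p ∈ K` and the supporting
hemisphere at `p` facing away from `x`. Width `δ` forces a point of `K` of height at least `sin δ`,
which is farther than `δ` from `x`. -/

/-! ### Inner products on the sphere -/

/-- The Euclidean inner product of two points of the sphere. -/
noncomputable def ip (a b : Sph d) : ℝ :=
  ⟪(a : EuclideanSpace ℝ (Fin (d + 1))), (b : EuclideanSpace ℝ (Fin (d + 1)))⟫_ℝ

lemma norm_coe (a : Sph d) : ‖(a : EuclideanSpace ℝ (Fin (d + 1)))‖ = 1 := by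
  simp

lemma ip_self (a : Sph d) : ip a a = 1 := by
  simp [ip]

lemma ip_comm (a b : Sph d) : ip a b = ip b a := real_inner_comm _ _

lemma ip_le_one (a b : Sph d) : ip a b ≤ 1 := by
  have := real_inner_le_norm (a : EuclideanSpace ℝ (Fin (d + 1))) b
  simpa [ip, norm_coe] using this

lemma neg_one_le_ip (a b : Sph d) : -1 ≤ ip a b := by
  have := neg_le_of_abs_le
    (abs_real_inner_le_norm (a : EuclideanSpace ℝ (Fin (d + 1))) (b : EuclideanSpace ℝ (Fin (d + 1))))
  simpa [ip, norm_coe] using this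

lemma eq_of_ip_eq_one {a b : Sph d} (h : ip a b = 1) : a = b :=
  Subtype.ext ((inner_eq_one_iff_of_norm_eq_one (norm_coe a) (norm_coe b)).1 h)

lemma ip_neg_right (a b : Sph d) : ip a (-b) = -ip a b := by
  simp [ip, inner_neg_right]

lemma continuous_ip_right (a : Sph d) : Continuous fun x => ip a x := by
  unfold ip; fun_prop

lemma cos_sdist (a b : Sph d) : Real.cos (sdist a b) = ip a b := by
  simp [sdist, InnerProductGeometry.cos_angle, ip]

lemma sdist_nonneg (a b : Sph d) : 0 ≤ sdist a b := InnerProductGeometry.angle_nonneg _ _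

lemma sdist_le_pi (a b : Sph d) : sdist a b ≤ Real.pi := InnerProductGeometry.angle_le_pi _ _

lemma sdist_le_iff {a b : Sph d} {t : ℝ} (h0 : 0 ≤ t) (h1 : t ≤ Real.pi) :
    sdist a b ≤ t ↔ Real.cos t ≤ ip a b := by
  rw [← cos_sdist]
  exact (Real.strictAntiOn_cos.le_iff_ge ⟨h0, h1⟩ ⟨sdist_nonneg a b, sdist_le_pi a b⟩).symm

lemma mem_hemisphere {g x : Sph d} : x ∈ hemisphere g ↔ 0 ≤ ip g x := by
  have := sdist_le_iff (a := g) (b := x) (t := Real.pi / 2)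
    (by positivity) (by linarith [Real.pi_pos])
  rw [Real.cos_pi_div_two] at this
  exact this

/-- Every nonzero vector is a positive multiple of a point of the sphere. -/
lemma exists_direction {v : EuclideanSpace ℝ (Fin (d + 1))} (hv : v ≠ 0) :
    ∃ x : Sph d, v = ‖v‖ • (x : EuclideanSpace ℝ (Fin (d + 1))) := by
  have hn : ‖v‖ ≠ 0 := norm_ne_zero_iff.2 hv
  refine ⟨⟨‖v‖⁻¹ • v, ?_⟩, ?_⟩
  · simp [norm_smul, hn]
  · simp [smul_smul, hn]

lemma norm_sq_combination (a b : Sph d) (s t : ℝ) :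
    ‖s • (a : EuclideanSpace ℝ (Fin (d + 1))) + t • (b : EuclideanSpace ℝ (Fin (d + 1)))‖ ^ 2
      = s ^ 2 + 2 * (s * t * ip a b) + t ^ 2 := by
  rw [norm_add_sq_real, norm_smul, norm_smul, norm_coe, norm_coe, real_inner_smul_left,
    real_inner_smul_right, ip]
  simp only [Real.norm_eq_abs, mul_one, sq_abs]
  ring

/-- Unit combinations of two orthogonal points are again points of the sphere. -/
lemma exists_combination {a b : Sph d} (hab : ip a b = 0) {s t : ℝ} (hst : s ^ 2 + t ^ 2 = 1) :
    ∃ x : Sph d, (x : EuclideanSpace ℝ (Fin (d + 1))) = s • (a : EuclideanSpace ℝ (Fin (d + 1)))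
      + t • (b : EuclideanSpace ℝ (Fin (d + 1))) := by
  refine ⟨⟨s • (a : EuclideanSpace ℝ (Fin (d + 1))) + t • (b : EuclideanSpace ℝ (Fin (d + 1))),
    ?_⟩, rfl⟩
  have := norm_sq_combination a b s t
  rw [hab] at this
  have h1 : ‖s • (a : EuclideanSpace ℝ (Fin (d + 1)))
      + t • (b : EuclideanSpace ℝ (Fin (d + 1)))‖ ^ 2 = 1 := by rw [this]; linarith
  rw [mem_sphere_zero_iff_norm]
  exact (sq_eq_sq₀ (norm_nonneg _) zero_le_one).1 (by rw [h1, one_pow])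

lemma ip_combination {a b x : Sph d} {s t : ℝ}
    (hx : (x : EuclideanSpace ℝ (Fin (d + 1))) = s • (a : EuclideanSpace ℝ (Fin (d + 1)))
      + t • (b : EuclideanSpace ℝ (Fin (d + 1)))) (y : Sph d) :
    ip x y = s * ip a y + t * ip b y := by
  simp only [ip, hx, inner_add_left, real_inner_smul_left]

lemma ip_of_smul_eq_combination {a b x : Sph d} {r s t : ℝ}
    (hx : s • (a : EuclideanSpace ℝ (Fin (d + 1))) + t • (b : EuclideanSpace ℝ (Fin (d + 1)))
      = r • (x : EuclideanSpace ℝ (Fin (d + 1)))) (y : Sph d) :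
    r * ip x y = s * ip a y + t * ip b y := by
  have := congrArg (fun v => ⟪v, (y : EuclideanSpace ℝ (Fin (d + 1)))⟫_ℝ) hx
  simp only [inner_add_left, real_inner_smul_left] at this
  exact this.symm

/-- Bessel's inequality for two orthogonal points of the sphere. -/
lemma ip_sq_add_ip_sq_le {a b : Sph d} (hab : ip a b = 0) (x : Sph d) :
    ip x a ^ 2 + ip x b ^ 2 ≤ 1 := by
  have h := norm_sq_combination a b (ip x a) (ip x b)
  have h2 := real_inner_le_norm (x : EuclideanSpace ℝ (Fin (d + 1)))
    (ip x a • (a : EuclideanSpace ℝ (Fin (d + 1))) + ip x b • (b : EuclideanSpace ℝ (Fin (d + 1))))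
  rw [norm_coe, one_mul, inner_add_right, real_inner_smul_right, real_inner_smul_right] at h2
  change ip x a * ip x a + ip x b * ip x b ≤ _ at h2
  rw [hab] at h
  set n := ‖ip x a • (a : EuclideanSpace ℝ (Fin (d + 1)))
    + ip x b • (b : EuclideanSpace ℝ (Fin (d + 1)))‖
  have hn : 0 ≤ n := norm_nonneg _
  nlinarith

/-! ### Hemispheres and their boundaries -/

lemma isClosed_hemisphere (g : Sph d) : IsClosed (hemisphere g) := by
  have : hemisphere g = {x | 0 ≤ ip g x} := by ext x; exact mem_hemisphere
  rw [this]
  exact isClosed_le continuous_const (continuous_ip_right g)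

/-- A point orthogonal to `g` is not interior to a set contained in the hemisphere of `g`. -/
lemma notMem_interior_of_ip_eq_zero {g x : Sph d} {K : Set (Sph d)} (hK : K ⊆ hemisphere g)
    (hx : ip g x = 0) : x ∉ interior K := by
  intro hxi
  have hxg : ip x g = 0 := by rw [ip_comm, hx]
  -- Rotating `x` away from `g` leaves the hemisphere immediately.
  choose γ hγ using fun t : ℝ => exists_combination hxg (s := Real.cos t) (t := -Real.sin t)
    (by rw [neg_sq]; exact Real.cos_sq_add_sin_sq t)
  have hcont : Continuous γ := by
    rw [continuous_induced_rng]
    have : (Subtype.val ∘ γ) = fun t : ℝ => Real.cos t • (x : EuclideanSpace ℝ (Fin (d + 1)))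
      + (-Real.sin t) • (g : EuclideanSpace ℝ (Fin (d + 1))) := funext hγ
    rw [this]
    fun_prop
  have h0 : γ 0 = x := Subtype.ext (by rw [hγ]; simp)
  have hev : ∀ᶠ t in 𝓝[>] (0 : ℝ), γ t ∈ K := by
    have : ∀ᶠ t in 𝓝 (0 : ℝ), γ t ∈ K :=
      hcont.continuousAt.eventually_mem (by rw [h0]; exact mem_interior_iff_mem_nhds.1 hxi)
    exact this.filter_mono nhdsWithin_le_nhds
  have hlt : ∀ᶠ t in 𝓝[>] (0 : ℝ), t ∈ Set.Ioo (0 : ℝ) Real.pi :=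
    Ioo_mem_nhdsGT Real.pi_pos
  obtain ⟨t, htK, ht⟩ := (hev.and hlt).exists
  have h1 := mem_hemisphere.1 (hK htK)
  rw [ip_comm, ip_combination (hγ t), hxg, ip_self] at h1
  linarith [Real.sin_pos_of_pos_of_lt_pi ht.1 ht.2]

lemma mem_frontier_hemisphere {g x : Sph d} : x ∈ frontier (hemisphere g) ↔ ip g x = 0 := by
  constructor
  · intro hx
    have : hemisphere g = {x | (0 : ℝ) ≤ ip g x} := by ext x; exact mem_hemisphere
    rw [this] at hx
    exact (frontier_le_subset_eq continuous_const (continuous_ip_right g) hx).symm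
  · intro hx
    rw [(isClosed_hemisphere g).frontier_eq]
    exact ⟨mem_hemisphere.2 hx.ge, notMem_interior_of_ip_eq_zero subset_rfl hx⟩

/-! ### Lunes and thickness -/

lemma IsLunePair.symm {g h : Sph d} (H : IsLunePair g h) : IsLunePair h g :=
  ⟨H.1.symm, fun e => H.2 (by rw [e, neg_neg])⟩

lemma IsLunePair.ip_sq_lt_one {g h : Sph d} (H : IsLunePair g h) : ip g h ^ 2 < 1 := by
  have h1 : ip g h ≠ 1 := fun e => H.1 (eq_of_ip_eq_one e)
  have h2 : ip g h ≠ -1 := fun e => H.2 (eq_of_ip_eq_one (by rw [ip_neg_right, e, neg_neg]))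
  have h3 := lt_of_le_of_ne (ip_le_one g h) h1
  have h4 := lt_of_le_of_ne (neg_one_le_ip g h) h2.symm
  nlinarith

lemma isLunePair_of_ip {g h : Sph d} (h1 : -1 < ip g h) (h2 : ip g h < 1) : IsLunePair g h := by
  constructor
  · rintro rfl
    rw [ip_self] at h2
    exact lt_irrefl _ h2
  · intro e
    have : h = -g := by rw [e, neg_neg]
    rw [this, ip_neg_right, ip_self] at h1
    exact lt_irrefl _ h1

/-- Orthogonal decomposition of the center of one hemisphere of a lune with respect to the
center of the other one. -/
lemma IsLunePair.exists_decomposition {g h : Sph d} (H : IsLunePair g h) :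
    ∃ e : Sph d, (h : EuclideanSpace ℝ (Fin (d + 1)))
      = ip g h • (g : EuclideanSpace ℝ (Fin (d + 1)))
        + √(1 - ip g h ^ 2) • (e : EuclideanSpace ℝ (Fin (d + 1))) := by
  have hc := H.ip_sq_lt_one
  have hr0 : 0 < √(1 - ip g h ^ 2) := Real.sqrt_pos.2 (by linarith)
  have hns := norm_sq_combination h g 1 (-ip g h)
  rw [ip_comm h g] at hns
  have hn : ‖(1 : ℝ) • (h : EuclideanSpace ℝ (Fin (d + 1)))
      + (-ip g h) • (g : EuclideanSpace ℝ (Fin (d + 1)))‖ = √(1 - ip g h ^ 2) := by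
    rw [← sq_eq_sq₀ (norm_nonneg _) hr0.le, hns, Real.sq_sqrt (by linarith)]; ring
  obtain ⟨e, he⟩ := exists_direction (v := (1 : ℝ) • (h : EuclideanSpace ℝ (Fin (d + 1)))
      + (-ip g h) • (g : EuclideanSpace ℝ (Fin (d + 1)))) (by
    rw [← norm_ne_zero_iff, hn]; exact hr0.ne')
  refine ⟨e, ?_⟩
  rw [hn] at he
  rw [← he]
  module

/-- The center of a face of a lune is the normalized projection of the center of the other
hemisphere. -/
lemma isFaceCenter_iff {g h p : Sph d} (H : IsLunePair g h) :
    IsFaceCenter g h p ↔ (h : EuclideanSpace ℝ (Fin (d + 1)))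
      = ip g h • (g : EuclideanSpace ℝ (Fin (d + 1)))
        + √(1 - ip g h ^ 2) • (p : EuclideanSpace ℝ (Fin (d + 1))) := by
  have hc := H.ip_sq_lt_one
  set c := ip g h with hcdef
  set r := √(1 - c ^ 2) with hr
  have hr0 : 0 < r := Real.sqrt_pos.2 (by linarith)
  have hr2 : r ^ 2 = 1 - c ^ 2 := Real.sq_sqrt (by linarith)
  have hmem : ∀ e : Sph d, (h : EuclideanSpace ℝ (Fin (d + 1)))
      = c • (g : EuclideanSpace ℝ (Fin (d + 1))) + r • (e : EuclideanSpace ℝ (Fin (d + 1))) →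
      IsFaceCenter g h e := by
    intro e he
    have hge : ip g e = 0 := by
      have := ip_combination he g
      rw [ip_self, ip_comm h g, ← hcdef, ip_comm e g] at this
      have : r * ip g e = 0 := by linarith
      exact (mul_eq_zero.1 this).resolve_left hr0.ne'
    refine ⟨mem_frontier_hemisphere.2 hge, ?_⟩
    ext x
    simp only [luneFace, Set.mem_inter_iff, Set.mem_ofPred_eq]
    refine and_congr_right fun hx => ?_
    have hx' := mem_frontier_hemisphere.1 hx
    have h1 : sdist e x ≤ Real.pi / 2 ↔ 0 ≤ ip e x := mem_hemisphere (g := e)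
    rw [h1, mem_hemisphere, ip_combination he, hx', mul_zero, zero_add]
    exact mul_nonneg_iff_of_pos_left hr0
  refine ⟨fun hp => ?_, hmem p⟩
  obtain ⟨e, he⟩ := H.exists_decomposition
  have hec := hmem e he
  suffices e = p by rw [← this]; exact he
  by_contra hne
  -- The direction of `e - p` lies in the face seen from `e` but makes an obtuse angle with `p`, so
  -- the two centers cannot describe the same face.
  obtain ⟨u, hu⟩ := exists_direction (v := (1 : ℝ) • (e : EuclideanSpace ℝ (Fin (d + 1)))
        + (-1 : ℝ) • (p : EuclideanSpace ℝ (Fin (d + 1)))) (by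
      rw [one_smul, neg_one_smul, ← sub_eq_add_neg, sub_ne_zero]
      exact fun hh => hne (Subtype.ext hh))
  set n := ‖(1 : ℝ) • (e : EuclideanSpace ℝ (Fin (d + 1)))
        + (-1 : ℝ) • (p : EuclideanSpace ℝ (Fin (d + 1)))‖ with hn
  have hn0 : 0 < n := by
    rw [hn, norm_pos_iff, one_smul, neg_one_smul, ← sub_eq_add_neg, sub_ne_zero]
    exact fun hh => hne (Subtype.ext hh)
  have hlt : ip e p < 1 := lt_of_le_of_ne (ip_le_one e p) fun hh => hne (eq_of_ip_eq_one hh)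
  have hug := ip_of_smul_eq_combination hu g
  have hue := ip_of_smul_eq_combination hu e
  have hup := ip_of_smul_eq_combination hu p
  have hge := mem_frontier_hemisphere.1 hec.1
  have hgp := mem_frontier_hemisphere.1 hp.1
  rw [ip_comm e g, ip_comm p g, hge, hgp] at hug
  rw [ip_self, ip_comm p e] at hue
  rw [ip_self] at hup
  have hug0 : ip g u = 0 := by
    rw [ip_comm]
    have : n * ip u g = 0 := by linarith
    exact (mul_eq_zero.1 this).resolve_left hn0.ne'
  have hue0 : 0 ≤ ip e u := by
    rw [ip_comm]
    exact ((mul_pos_iff_of_pos_left hn0).1 (by linarith)).le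
  have h1 : u ∈ luneFace g h := by
    rw [hec.2]
    exact ⟨mem_frontier_hemisphere.2 hug0, mem_hemisphere.2 hue0⟩
  rw [hp.2] at h1
  have h2 : 0 ≤ ip p u := mem_hemisphere.1 h1.2
  rw [ip_comm] at h2
  have := mul_nonneg hn0.le h2
  linarith

lemma IsLunePair.exists_isFaceCenter {g h : Sph d} (H : IsLunePair g h) :
    ∃ p, IsFaceCenter g h p := by
  obtain ⟨p, hp⟩ := H.exists_decomposition
  exact ⟨p, (isFaceCenter_iff H).2 hp⟩

/-- The centers of the two faces of a lune are at distance `π` minus the distance of the centers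
of the hemispheres. -/
lemma IsFaceCenter.sdist_eq {g h p q : Sph d} (H : IsLunePair g h) (hp : IsFaceCenter g h p)
    (hq : IsFaceCenter h g q) : sdist p q = Real.pi - sdist g h := by
  have hc := H.ip_sq_lt_one
  have hp' := (isFaceCenter_iff H).1 hp
  have hq' := (isFaceCenter_iff H.symm).1 hq
  rw [ip_comm h g] at hq'
  have hr0 : 0 < √(1 - ip g h ^ 2) := Real.sqrt_pos.2 (by linarith)
  have hr2 : √(1 - ip g h ^ 2) ^ 2 = 1 - ip g h ^ 2 := Real.sq_sqrt (by linarith)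
  set r := √(1 - ip g h ^ 2)
  have hhq : ip h q = 0 := mem_frontier_hemisphere.1 hq.1
  have h1 := ip_combination hq' g
  rw [ip_self, ip_comm h g] at h1
  have hqg : ip q g = r := mul_left_cancel₀ hr0.ne' (by linarith)
  have h2 := ip_combination hp' q
  rw [hhq, ip_comm g q, hqg] at h2
  have hpq : ip p q = -ip g h := mul_left_cancel₀ hr0.ne' (by linarith)
  refine Real.injOn_cos ⟨sdist_nonneg _ _, sdist_le_pi _ _⟩
    ⟨by linarith [sdist_le_pi g h], by linarith [sdist_nonneg g h]⟩ ?_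
  rw [cos_sdist, Real.cos_pi_sub, cos_sdist, hpq]

/-- Eliminates face centers: minimizing thickness becomes maximizing `sdist g h`. -/
lemma hasThickness_iff {g h : Sph d} (H : IsLunePair g h) {t : ℝ} :
    HasThickness g h t ↔ t = Real.pi - sdist g h := by
  constructor
  · rintro ⟨p, q, hp, hq, rfl⟩
    exact hp.sdist_eq H hq
  · rintro rfl
    obtain ⟨p, hp⟩ := H.exists_isFaceCenter
    obtain ⟨q, hq⟩ := H.symm.exists_isFaceCenter
    exact ⟨p, q, hp, hq, hp.sdist_eq H hq⟩

/-! ### Diameter, nearest points and heights -/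

lemma sdist_le_sdiam {A : Set (Sph d)} {a b : Sph d} (ha : a ∈ A) (hb : b ∈ A) :
    sdist a b ≤ sdiam A := by
  refine le_csSup ⟨Real.pi, ?_⟩ ⟨a, ha, b, hb, rfl⟩
  rintro t ⟨x, -, y, -, rfl⟩
  exact sdist_le_pi x y

lemma cos_sdiam_le_ip {A : Set (Sph d)} (hA : sdiam A ≤ Real.pi) {a b : Sph d} (ha : a ∈ A)
    (hb : b ∈ A) : Real.cos (sdiam A) ≤ ip a b :=
  (sdist_le_iff ((sdist_nonneg a b).trans (sdist_le_sdiam ha hb)) hA).1 (sdist_le_sdiam ha hb)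

/-- A point outside a set such that adding it increases the diameter is far from some point of
the set. -/
lemma exists_ip_lt_of_sdiam_lt {K : Set (Sph d)} (hne : K.Nonempty) (hK : sdiam K ≤ Real.pi)
    {x : Sph d} (hx : sdiam K < sdiam (insert x K)) : ∃ q ∈ K, ip q x < Real.cos (sdiam K) := by
  by_contra! hcon
  obtain ⟨k, hk⟩ := hne
  have h0 : 0 ≤ sdiam K := (sdist_nonneg k k).trans (sdist_le_sdiam hk hk)
  refine hx.not_ge (csSup_le ⟨_, x, Or.inl rfl, x, Or.inl rfl, rfl⟩ ?_)
  rintro t ⟨a, ha, b, hb, rfl⟩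
  rw [sdist_le_iff h0 hK]
  rcases ha with rfl | ha <;> rcases hb with rfl | hb
  · rw [ip_self]; exact Real.cos_le_one _
  · rw [ip_comm]; exact hcon b hb
  · exact hcon a ha
  · exact cos_sdiam_le_ip hK ha hb

/-- First-order condition at a point `p` of a convex set that is nearest to `x`. -/
lemma IsConvex.ip_le_of_isMaxOn {K : Set (Sph d)} (hK : IsConvex K)
    (hpos : ∀ a ∈ K, ∀ b ∈ K, 0 < ip a b) {x p : Sph d} (hp : p ∈ K)
    (hmax : ∀ k ∈ K, ip x k ≤ ip x p) (hxp : 0 ≤ ip x p) {k : Sph d} (hk : k ∈ K) :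
    ip x k ≤ ip x p * ip p k := by
  -- Compare `p` with the normalization of `p + t • k`, a point of the arc `pk`; letting `t → 0`
  -- removes the error term.
  have key : ∀ t > 0, ip x k ≤ ip x p * ip p k + ip x p / 2 * t := by
    intro t ht
    have hns := norm_sq_combination p k 1 t
    set v := (1 : ℝ) • (p : EuclideanSpace ℝ (Fin (d + 1)))
      + t • (k : EuclideanSpace ℝ (Fin (d + 1))) with hv
    have hpk := hpos p hp k hk
    have hn2 : 0 < ‖v‖ ^ 2 := by rw [hns]; positivity
    have hn : 0 < ‖v‖ := lt_of_le_of_ne (norm_nonneg v) fun h0 => by simp [← h0] at hn2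
    obtain ⟨y, hy⟩ := exists_direction (v := v) (norm_pos_iff.1 hn)
    have hyK : y ∈ K := by
      refine hK.2 p hp k hk ⟨‖v‖⁻¹ * 1, ‖v‖⁻¹ * t, by positivity, by positivity, ?_⟩
      rw [mul_smul, mul_smul, ← smul_add, ← hv]
      nth_rewrite 2 [hy]
      rw [smul_smul, inv_mul_cancel₀ hn.ne', one_smul]
    have h1 := ip_of_smul_eq_combination hy x
    rw [ip_comm y, ip_comm p, ip_comm k] at h1
    have h2 := mul_le_mul_of_nonneg_left (hmax y hyK) hn.le
    have h3 : ‖v‖ ≤ 1 + t * ip p k + t ^ 2 / 2 := by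
      refine (sq_le_sq₀ hn.le (by positivity)).1 ?_
      rw [hns]
      nlinarith [sq_nonneg (t * ip p k + t ^ 2 / 2)]
    have h4 := mul_le_mul_of_nonneg_right h3 hxp
    refine le_of_mul_le_mul_left ?_ ht
    nlinarith
  refine le_of_forall_pos_le_add fun ε hε => ?_
  have hden : 0 < ip x p / 2 + 1 := by positivity
  have := key (ε / (ip x p / 2 + 1)) (by positivity)
  have h2 : ip x p / 2 * (ε / (ip x p / 2 + 1)) ≤ ε := by
    rw [mul_div_assoc', div_le_iff₀ hden]
    nlinarith
  linarith

/-- By Bessel, a point within `δ` of `p` has height at most `sin δ` over a great sphere through `p`.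
-/
lemma ip_le_sin {δ : ℝ} (hs : 0 ≤ Real.sin δ) (hc : 0 ≤ Real.cos δ) {g p k : Sph d}
    (hgp : ip g p = 0) (hk : Real.cos δ ≤ ip p k) : ip g k ≤ Real.sin δ := by
  have h1 := ip_sq_add_ip_sq_le hgp k
  rw [ip_comm k g, ip_comm k p] at h1
  nlinarith [Real.sin_sq_add_cos_sq δ]

/-! ### Complete bodies have constant width -/

/-- If every point outside of `K` is at distance greater than `δ` from some point of `K`, then `K`
contains the point at distance `δ` from a boundary point in the direction of an inner normal. -/
lemma exists_mem_eq_cos_smul_add_sin_smul {δ : ℝ} (hs : 0 < Real.sin δ) (hc : 0 < Real.cos δ)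
    {K : Set (Sph d)} (hKc : IsClosed K) (hK : ∀ a ∈ K, ∀ b ∈ K, Real.cos δ ≤ ip a b)
    (hfar : ∀ x ∉ K, ∃ q ∈ K, ip q x < Real.cos δ) {g p : Sph d}
    (hg : ∀ k ∈ K, 0 ≤ ip g k) (hp : p ∈ K) (hgp : ip g p = 0) :
    ∃ k ∈ K, (k : EuclideanSpace ℝ (Fin (d + 1)))
      = Real.cos δ • (p : EuclideanSpace ℝ (Fin (d + 1)))
        + Real.sin δ • (g : EuclideanSpace ℝ (Fin (d + 1))) := by
  obtain ⟨k, hk⟩ := exists_combination (a := p) (b := g) (by rw [ip_comm, hgp])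
    (Real.cos_sq_add_sin_sq δ)
  refine ⟨k, ?_, hk⟩
  by_contra hkK
  obtain ⟨q, hq, hqk⟩ := hfar k hkK
  rw [ip_comm, ip_combination hk] at hqk
  -- The room for `σ` is exactly the strict inequality `ip q k < cos δ`.
  obtain ⟨σ, hσ1, hσ2⟩ : ∃ σ, ip g q < σ ∧ σ < Real.cos δ * (1 - ip p q) / Real.sin δ := by
    apply exists_between
    rw [lt_div_iff₀ hs]
    linarith
  rw [lt_div_iff₀ hs] at hσ2
  have hσ0 : 0 ≤ σ := (hg q hq).trans hσ1.le
  -- The tangential part of `q` at `p`, tilted by `σ` just enough to point out of the hemisphere of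
  -- `g`.
  set v : EuclideanSpace ℝ (Fin (d + 1)) := q - ip p q • (p : EuclideanSpace ℝ (Fin (d + 1)))
    - σ • (g : EuclideanSpace ℝ (Fin (d + 1))) with hv
  have hzv : ∀ z : Sph d, ⟪(z : EuclideanSpace ℝ (Fin (d + 1))), v⟫_ℝ
      = ip z q - ip p q * ip z p - σ * ip z g := by
    intro z
    simp only [hv, inner_sub_right, real_inner_smul_right, ip]
  have hpv : ⟪(p : EuclideanSpace ℝ (Fin (d + 1))), v⟫_ℝ = 0 := by
    rw [hzv, ip_self, ip_comm p g, hgp]; ring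
  have hgv : ⟪(g : EuclideanSpace ℝ (Fin (d + 1))), v⟫_ℝ < 0 := by
    rw [hzv, ip_self, hgp]; linarith
  -- The normalization of `p + ε • v` is outside `K`, hence farther than `δ` from some `z ∈ K`. As
  -- `z` is within `δ` of `p`, it is nearly not ahead in direction `v`.
  have hstep : ∀ ε : ℝ, 0 < ε → ∃ z ∈ K,
      ⟪(z : EuclideanSpace ℝ (Fin (d + 1))), v⟫_ℝ ≤ Real.cos δ * ‖v‖ ^ 2 / 2 * ε ∧
      ip z p ≤ Real.cos δ + Real.cos δ * ‖v‖ ^ 2 / 2 * ε ^ 2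
        - ε * ⟪(z : EuclideanSpace ℝ (Fin (d + 1))), v⟫_ℝ := by
    intro ε hε
    have hns : ‖(p : EuclideanSpace ℝ (Fin (d + 1))) + ε • v‖ ^ 2 = 1 + ε ^ 2 * ‖v‖ ^ 2 := by
      rw [norm_add_sq_real, real_inner_smul_right, hpv, norm_coe, norm_smul, mul_pow,
        Real.norm_eq_abs, sq_abs]
      ring
    set w := (p : EuclideanSpace ℝ (Fin (d + 1))) + ε • v with hw
    have hn : 0 < ‖w‖ := lt_of_le_of_ne (norm_nonneg w) fun h0 => by
      rw [← h0] at hns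
      nlinarith [sq_nonneg (ε * ‖v‖)]
    obtain ⟨x, hx⟩ := exists_direction (v := w) (norm_pos_iff.1 hn)
    have hip : ∀ z : Sph d, ip z p + ε * ⟪(z : EuclideanSpace ℝ (Fin (d + 1))), v⟫_ℝ
        = ‖w‖ * ip z x := by
      intro z
      have := congrArg (fun u => ⟪(z : EuclideanSpace ℝ (Fin (d + 1))), u⟫_ℝ) hx
      simp only [real_inner_smul_right] at this
      rw [hw, inner_add_right, real_inner_smul_right, ← hw] at this
      exact this
    have hxK : x ∉ K := by
      intro hxK
      have h1 := hip g
      have h2 := mul_nonneg hn.le (hg x hxK)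
      rw [hgp] at h1
      nlinarith [mul_pos hε (neg_pos.2 hgv)]
    obtain ⟨z, hz, hzx⟩ := hfar x hxK
    have hw1 : ‖w‖ ≤ 1 + ε ^ 2 * ‖v‖ ^ 2 / 2 := by
      refine (sq_le_sq₀ hn.le (by positivity)).1 ?_
      rw [hns]
      nlinarith [sq_nonneg (ε ^ 2 * ‖v‖ ^ 2)]
    have h1 := hip z
    have h2 := mul_le_mul_of_nonneg_left hzx.le hn.le
    have h3 := mul_le_mul_of_nonneg_right hw1 hc.le
    have h4 := hK z hz p hp
    refine ⟨z, hz, le_of_mul_le_mul_left ?_ hε, ?_⟩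
    · nlinarith
    · nlinarith
  choose z hzK hz1 hz2 using fun n : ℕ => hstep (1 / ((n : ℝ) + 1)) Nat.one_div_pos_of_nat
  obtain ⟨z₀, hz₀, φ, hφ, hlim⟩ := hKc.isCompact.tendsto_subseq hzK
  have hε : Tendsto (fun n => 1 / ((φ n : ℝ) + 1)) atTop (𝓝 0) :=
    tendsto_one_div_add_atTop_nhds_zero_nat.comp hφ.tendsto_atTop
  have hlv : Tendsto (fun n => ⟪(z (φ n) : EuclideanSpace ℝ (Fin (d + 1))), v⟫_ℝ) atTop
      (𝓝 ⟪(z₀ : EuclideanSpace ℝ (Fin (d + 1))), v⟫_ℝ) := by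
    have : Continuous fun y : Sph d => ⟪(y : EuclideanSpace ℝ (Fin (d + 1))), v⟫_ℝ := by fun_prop
    exact (this.tendsto z₀).comp hlim
  have hlp : Tendsto (fun n => ip (z (φ n)) p) atTop (𝓝 (ip z₀ p)) := by
    have := ((continuous_ip_right p).tendsto z₀).comp hlim
    simpa only [Function.comp_def, ip_comm p] using this
  have hv0 : ⟪(z₀ : EuclideanSpace ℝ (Fin (d + 1))), v⟫_ℝ ≤ 0 := by
    have := le_of_tendsto_of_tendsto' hlv (hε.const_mul (Real.cos δ * ‖v‖ ^ 2 / 2))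
      fun n => hz1 (φ n)
    simpa using this
  have hp0 : ip z₀ p ≤ Real.cos δ := by
    have := le_of_tendsto_of_tendsto' hlp
      ((((hε.pow 2).const_mul (Real.cos δ * ‖v‖ ^ 2 / 2)).const_add (Real.cos δ)).sub
        (hε.mul hlv)) fun n => hz2 (φ n)
    simpa using this
  have hp1 : ip z₀ p = Real.cos δ := le_antisymm hp0 (hK z₀ hz₀ p hp)
  have hgz := ip_le_sin hs.le hc.le hgp (by rw [ip_comm, hp1] : Real.cos δ ≤ ip p z₀)
  rw [hzv, hp1, ip_comm z₀ g] at hv0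
  -- `⟪z₀, v⟫ ≤ 0` gives `ip z₀ q ≤ cos δ * ip p q + σ * sin δ < cos δ`, against the diameter bound.
  nlinarith [hK z₀ hz₀ q hq, mul_le_mul_of_nonneg_left hgz hσ0]

/-- The width determined by a supporting hemisphere of a set of diameter at most `δ` is `δ` if the
point at distance `δ` from a contact point in the direction of the inner normal belongs to the
set. -/
lemma hasWidth_of_mem {δ : ℝ} (hδ0 : 0 < δ) (hδ1 : δ < Real.pi / 2) {K : Set (Sph d)}
    (hK : ∀ a ∈ K, ∀ b ∈ K, Real.cos δ ≤ ip a b) {g p k : Sph d}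
    (hg : K ⊆ hemisphere g) (hp : p ∈ K) (hgp : ip g p = 0) (hk : k ∈ K)
    (hkeq : (k : EuclideanSpace ℝ (Fin (d + 1)))
      = Real.cos δ • (p : EuclideanSpace ℝ (Fin (d + 1)))
        + Real.sin δ • (g : EuclideanSpace ℝ (Fin (d + 1)))) :
    HasWidth g K δ := by
  have hs : 0 < Real.sin δ := Real.sin_pos_of_pos_of_lt_pi hδ0 (by linarith)
  have hc : 0 < Real.cos δ := Real.cos_pos_of_mem_Ioo ⟨by linarith, hδ1⟩
  have hsc := Real.sin_sq_add_cos_sq δ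
  constructor
  -- The optimal `h` is orthogonal to `k`, so its hemisphere touches `K` there.
  · obtain ⟨h, hh⟩ := exists_combination (a := p) (b := g) (by rw [ip_comm, hgp])
      (s := Real.sin δ) (t := -Real.cos δ) (by linarith)
    have hgh : ip g h = -Real.cos δ := by
      rw [ip_comm, ip_combination hh, ip_comm p g, hgp, ip_self]; ring
    have hl : IsLunePair g h := isLunePair_of_ip (by rw [hgh]; nlinarith) (by rw [hgh]; linarith)
    refine ⟨h, hl, fun z hz => ⟨hg hz, mem_hemisphere.2 ?_⟩, (hasThickness_iff hl).2 ?_⟩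
    · rw [ip_combination hh]
      have h1 := hK p hp z hz
      have h2 := ip_le_sin hs.le hc.le hgp h1
      nlinarith
    · have : sdist g h = Real.pi - δ := by
        refine Real.injOn_cos ⟨sdist_nonneg _ _, sdist_le_pi _ _⟩
          ⟨by linarith, by linarith⟩ ?_
        rw [cos_sdist, hgh, Real.cos_pi_sub]
      linarith
  · rintro t ⟨h, hl, hKh, ht⟩
    rw [hasThickness_iff hl] at ht
    have hsd : sdist g h ≤ Real.pi - δ := by
      -- If `ip g h < -cos δ`, Bessel forces `ip p h < sin δ`, and then `ip k h < 0`: a thinner lune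
      -- misses `k`.
      rw [sdist_le_iff (by linarith) (by linarith), Real.cos_pi_sub]
      by_contra! hlt
      have h1 := mem_hemisphere.1 (hKh hk).2
      rw [ip_comm, ip_combination hkeq] at h1
      have h2 := ip_sq_add_ip_sq_le hgp h
      rw [ip_comm h g, ip_comm h p] at h2
      have h3 : ip p h < Real.sin δ := by nlinarith
      nlinarith
    linarith

/-! ### Bodies of constant width are complete -/

/-- A convex set whose width determined by a supporting hemisphere is `δ` contains a point at
distance at least `δ` from the boundary of this hemisphere. -/
lemma IsConvex.exists_sin_le_ip_of_hasWidth {δ : ℝ} (hδ0 : 0 < δ) (hδ1 : δ < Real.pi / 2)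
    {K : Set (Sph d)} (hKcv : IsConvex K) (hKc : IsClosed K) (hint : (interior K).Nonempty)
    (hpos : ∀ a ∈ K, ∀ b ∈ K, 0 < ip a b) {g : Sph d} (hg : Supports g K)
    (hw : HasWidth g K δ) : ∃ k ∈ K, Real.sin δ ≤ ip g k := by
  have hs : 0 < Real.sin δ := Real.sin_pos_of_pos_of_lt_pi hδ0 (by linarith)
  have hc : 0 < Real.cos δ := Real.cos_pos_of_mem_Ioo ⟨by linarith, hδ1⟩
  have hsc := Real.sin_sq_add_cos_sq δ
  obtain ⟨hgK, p, hpf, hp⟩ := hg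
  have hgp := mem_frontier_hemisphere.1 hpf
  obtain ⟨m, hm, hmax⟩ := hKc.isCompact.exists_isMaxOn ⟨p, hp⟩ (continuous_ip_right g).continuousOn
  refine ⟨m, hm, ?_⟩
  have hm0 : 0 < ip g m := by
    obtain ⟨x, hx⟩ := hint
    have hxK := interior_subset hx
    exact (lt_of_le_of_ne (mem_hemisphere.1 (hgK hxK))
      fun h0 => notMem_interior_of_ip_eq_zero hgK h0.symm hx).trans_le (hmax hxK)
  have hm1 : ip g m < 1 := lt_of_le_of_ne (ip_le_one g m) fun h1 => by
    have := hpos m hm p hp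
    rw [← eq_of_ip_eq_one h1, hgp] at this
    exact lt_irrefl _ this
  have hns := norm_sq_combination m g (ip g m) (-1)
  rw [ip_comm m g] at hns
  -- Its direction `h` is orthogonal to the highest point `m`, and the lune thickness has cosine
  -- `‖v‖`, hence sine `ip g m`.
  set v := ip g m • (m : EuclideanSpace ℝ (Fin (d + 1)))
    + (-1 : ℝ) • (g : EuclideanSpace ℝ (Fin (d + 1)))
  have hv2 : ‖v‖ ^ 2 = 1 - ip g m ^ 2 := by rw [hns]; ring
  have hn : 0 < ‖v‖ := lt_of_le_of_ne (norm_nonneg v) fun h0 => by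
    rw [← h0] at hv2
    nlinarith
  obtain ⟨h, hh⟩ := exists_direction (v := v) (norm_pos_iff.1 hn)
  have hhg := ip_of_smul_eq_combination hh g
  rw [ip_self, ip_comm m g, ip_comm h g] at hhg
  have hgh : ip g h = -‖v‖ := mul_left_cancel₀ hn.ne' (by nlinarith)
  have hl : IsLunePair g h := isLunePair_of_ip (by rw [hgh]; nlinarith) (by rw [hgh]; linarith)
  have hKl : K ⊆ lune g h := fun k hk => ⟨hgK hk, mem_hemisphere.2 (by
    have h1 := ip_of_smul_eq_combination hh k
    have h2 := hKcv.ip_le_of_isMaxOn hpos hm (fun k hk => hmax hk) hm0.le hk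
    exact (mul_nonneg_iff_of_pos_left hn).1 (by linarith))⟩
  have h1 := hw.2 ⟨h, hl, hKl, (hasThickness_iff hl).2 rfl⟩
  have h2 : sdist g h ≤ Real.pi - δ := by linarith
  rw [sdist_le_iff (by linarith) (by linarith), Real.cos_pi_sub, hgh] at h2
  nlinarith

/-- Every point outside of a convex body of constant width `δ` and diameter at most `δ` is at
distance greater than `δ` from some point of the body. -/
lemma IsConvexBody.exists_ip_lt_cos_of_isConstantWidth {δ : ℝ} (hδ0 : 0 < δ)
    (hδ1 : δ < Real.pi / 2) {K : Set (Sph d)} (hKb : IsConvexBody K)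
    (hK : ∀ a ∈ K, ∀ b ∈ K, Real.cos δ ≤ ip a b) (hcw : IsConstantWidth K δ) {x : Sph d}
    (hx : x ∉ K) : ∃ q ∈ K, ip q x < Real.cos δ := by
  have hs : 0 < Real.sin δ := Real.sin_pos_of_pos_of_lt_pi hδ0 (by linarith)
  have hc : 0 < Real.cos δ := Real.cos_pos_of_mem_Ioo ⟨by linarith, hδ1⟩
  have hsc := Real.sin_sq_add_cos_sq δ
  by_contra! hcon
  have hpos : ∀ a ∈ K, ∀ b ∈ K, 0 < ip a b := fun a ha b hb => hc.trans_le (hK a ha b hb)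
  obtain ⟨p, hp, hmax⟩ := hKb.isClosed.isCompact.exists_isMaxOn
    (hKb.interior_nonempty.mono interior_subset) (continuous_ip_right x).continuousOn
  have hxp0 : 0 < ip x p := by rw [ip_comm]; exact hc.trans_le (hcon p hp)
  have hxp1 : ip x p < 1 := lt_of_le_of_ne (ip_le_one x p) fun h1 =>
    hx (by rw [eq_of_ip_eq_one h1]; exact hp)
  have hns := norm_sq_combination p x (ip x p) (-1)
  rw [ip_comm p x] at hns
  -- The tangent direction at `p` pointing away from `x`; `p` being nearest makes its hemisphere
  -- support `K`.
  set v := ip x p • (p : EuclideanSpace ℝ (Fin (d + 1)))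
    + (-1 : ℝ) • (x : EuclideanSpace ℝ (Fin (d + 1)))
  have hv2 : ‖v‖ ^ 2 = 1 - ip x p ^ 2 := by rw [hns]; ring
  have hn : 0 < ‖v‖ := lt_of_le_of_ne (norm_nonneg v) fun h0 => by
    rw [← h0] at hv2
    nlinarith
  obtain ⟨g, hg⟩ := exists_direction (v := v) (norm_pos_iff.1 hn)
  have hgy := ip_of_smul_eq_combination hg
  have hgp : ip g p = 0 := by
    have := hgy p
    rw [ip_self] at this
    exact (mul_eq_zero.1 (by linarith : ‖v‖ * ip g p = 0)).resolve_left hn.ne'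
  have hsup : Supports g K := by
    refine ⟨fun k hk => mem_hemisphere.2 ?_, p, mem_frontier_hemisphere.2 hgp, hp⟩
    have h2 := hKb.convex.ip_le_of_isMaxOn hpos hp (fun k hk => hmax hk) hxp0.le hk
    exact (mul_nonneg_iff_of_pos_left hn).1 (by linarith [hgy k])
  obtain ⟨k, hk, hgk⟩ := hKb.convex.exists_sin_le_ip_of_hasWidth hδ0 hδ1 hKb.isClosed
    hKb.interior_nonempty hpos hsup (hcw g hsup)
  have h1 := ip_sq_add_ip_sq_le hgp k
  rw [ip_comm k g, ip_comm k p] at h1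
  have hpk : ip p k ≤ Real.cos δ := by nlinarith
  have h2 := hgy k
  have h3 := hcon k hk
  rw [ip_comm] at h3
  -- `ip x k = ip x p * ip p k - ‖v‖ * ip g k` is strictly below `cos δ`.
  nlinarith [mul_pos hn (hs.trans_le hgk), mul_le_mul_of_nonneg_left hpk hxp0.le]

end SphConv

theorem theorem2 (d : ℕ) (hd : 2 ≤ d) (δ : ℝ) (hδ_pos : 0 < δ) (hδ_lt : δ < Real.pi / 2)
    (K : Set (SphConv.Sph d)) (hK : SphConv.IsConvexBody K) (hdiam : SphConv.sdiam K = δ) :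
    SphConv.IsCompleteSet K ↔ SphConv.IsConstantWidth K δ := by
  subst hdiam
  have hpi := Real.pi_pos
  have hs : 0 < Real.sin (SphConv.sdiam K) :=
    Real.sin_pos_of_pos_of_lt_pi hδ_pos (by linarith)
  have hc : 0 < Real.cos (SphConv.sdiam K) := Real.cos_pos_of_mem_Ioo ⟨by linarith, hδ_lt⟩
  have hne : K.Nonempty := hK.interior_nonempty.mono interior_subset
  have hle : SphConv.sdiam K ≤ Real.pi := by linarith
  have hip : ∀ a ∈ K, ∀ b ∈ K, Real.cos (SphConv.sdiam K) ≤ SphConv.ip a b :=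
    fun a ha b hb => SphConv.cos_sdiam_le_ip hle ha hb
  constructor
  · rintro hcomp g ⟨hgK, p, hpf, hp⟩
    have hgp := SphConv.mem_frontier_hemisphere.1 hpf
    obtain ⟨k, hk, hkeq⟩ := SphConv.exists_mem_eq_cos_smul_add_sin_smul hs hc hK.isClosed hip
      (fun x hx => SphConv.exists_ip_lt_of_sdiam_lt hne hle (hcomp.diam_insert x hx))
      (fun k hk => SphConv.mem_hemisphere.1 (hgK hk)) hp hgp
    exact SphConv.hasWidth_of_mem hδ_pos hδ_lt hip hgK hp hgp hk hkeq
  · intro hcw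
    obtain ⟨c, hcK⟩ := hne
    refine ⟨hδ_pos, hδ_lt,
      ⟨c, fun x hx => SphConv.mem_hemisphere.2 (hc.le.trans (hip c hcK x hx))⟩, fun x hx => ?_⟩
    obtain ⟨q, hq, hqx⟩ := hK.exists_ip_lt_cos_of_isConstantWidth hδ_pos hδ_lt hip hcw hx
    have h1 : SphConv.sdiam K < SphConv.sdist q x := by
      by_contra! hcon
      exact hqx.not_ge ((SphConv.sdist_le_iff hδ_pos.le hle).1 hcon)
    exact h1.trans_le (SphConv.sdist_le_sdiam (Or.inr hq) (Or.inl rfl))
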